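/- Let $0<\alpha<1$, $\rho>0$, $\mu>0$, and let $\{M(t)\}_{t\ge 0}$ be a Mittag-Leffler Lévy process, i.e. a Lévy process on $[0,\infty)$ with non-decreasing right-continuous paths, $M(0)=0$, and Laplace transform $\mathbb{E}[e^{-uM(t)}]=\left(\frac{\mu}{\mu+u^\alpha}\right)^{\rho t}$ for $u,t\ge 0$. (1) For every $0<l<\alpha/2$ and $t\ge 0$, the moments $\mathbb{E}[M^{l}(t)]$ and $\mathbb{E}[M^{2l}(t)]$ are finite and $$\left(\mathbb{E}[M^{l}(t)]\right)^2\le \mathbb{E}[M^{2l}(t)].$$ (2) Let $0<\beta<\alpha/2$ and $\lambda>0$, and let $\{N_\beta(t,\lambda)\}_{t\ge 0}$ be a fractional Poisson process independent of $\{M(t)\}_{t\ge0}$, i.e. the renewal process $N_\beta(t,\lambda)=\max\{n\ge 0: J_1+\dots+J_n\le t\}$ with i.i.d. waiting times satisfying $\mathbb{P}(J_i>t)=\sum_{k\ge 0}\frac{(-\lambda t^\beta)^k}{\Gamma(\beta k+1)}$ for $t\ge 0$. Let $\mathcal{G}(t)=N_\beta(M(t),\lambda)$ be the generalized fractional negative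 binomial process (GFNBP). Then for every $t\ge0$, $\mathcal{G}(t)$ has a finite second moment and $$\mathrm{Var}[\mathcal{G}(t)]-\mathbb{E}[\mathcal{G}(t)]=\frac{\lambda^2}{\beta}\left(\frac{\mathbb{E}[M^{2\beta}(t)]}{\Gamma(2\beta)}-\frac{\left(\mathbb{E}[M^{\beta}(t)]\right)^2}{\beta\,\Gamma(\beta)^2}\right)\ge 0,$$ with strict inequality $\mathrm{Var}[\mathcal{G}(t)]-\mathbb{E}[\mathcal{G}(t)]>0$ for every $t>0$; that is, the GFNBP is overdispersed. -/

import Mathlib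

open MeasureTheory ProbabilityTheory
open scoped NNReal

noncomputable section

/-- The (one-parameter) Mittag-Leffler function `∑ₖ zᵏ / Γ(β k + 1)`. -/
def mittagLeffler (β z : ℝ) : ℝ :=
  ∑' k : ℕ, z ^ k / Real.Gamma (β * k + 1)

/-- The counting process of the renewal sequence with waiting times `J 0, J 1, …`:
the largest `n` such that `J 0 + ⋯ + J (n - 1) ≤ t`. -/
def renewalCount {Ω : Type*} (J : ℕ → Ω → ℝ) (t : ℝ) (ω : Ω) : ℕ :=
  sSup {n : ℕ | ∑ i ∈ Finset.range n, J i ω ≤ t}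

/-- `N` is a fractional Poisson process of order `β` and intensity `lam`: the renewal process whose
independent waiting times have the Mittag-Leffler law `P(J > t) = E_β(-lam t^β)`, `t ≥ 0`. -/
structure IsFractionalPoissonProcess {Ω : Type*} [MeasurableSpace Ω]
    (β lam : ℝ) (N : ℝ≥0 → Ω → ℕ) (P : Measure Ω) : Prop where
  measurable : ∀ t, Measurable (N t)
  renewal : ∃ J : ℕ → Ω → ℝ,
    (∀ n, Measurable (J n)) ∧
    iIndepFun J P ∧
    (∀ n, ∀ t : ℝ, 0 ≤ t →
      P.real {ω | t < J n ω} = mittagLeffler β (-(lam * t ^ β))) ∧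
    ∀ᵐ ω ∂P, ∀ t : ℝ≥0, N t ω = renewalCount J t ω

/-- `M` is a Mittag-Leffler Lévy process (subordinator) with parameters `α, ρ, μ`: a Lévy process
on `[0, ∞)` with non-decreasing right-continuous paths and Laplace transform
`E[exp (-u M(t))] = (μ / (μ + u^α)) ^ (ρ t)`. -/
structure IsMittagLefflerLevyProcess {Ω : Type*} [MeasurableSpace Ω]
    (α ρ μ : ℝ) (M : ℝ≥0 → Ω → ℝ≥0) (P : Measure Ω) : Prop where
  measurable : ∀ t, Measurable (M t)
  zero : ∀ᵐ ω ∂P, M 0 ω = 0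
  indep_increments : HasIndepIncrements (fun t ω => (M t ω : ℝ)) P
  stationary_increments : ∀ s t : ℝ≥0,
    IdentDistrib (fun ω => (M (s + t) ω : ℝ) - (M s ω : ℝ)) (fun ω => (M t ω : ℝ)) P P
  paths : ∀ᵐ ω ∂P, Monotone (fun t => M t ω) ∧
    ∀ t, ContinuousWithinAt (fun t => M t ω) (Set.Ici t) t
  laplace : ∀ t : ℝ≥0, ∀ u : ℝ, 0 ≤ u →
    ∫ ω, Real.exp (-(u * (M t ω : ℝ))) ∂P = (μ / (μ + u ^ α)) ^ (ρ * (t : ℝ))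

/-- The process `N` time-changed by `M`: `t ↦ N(M(t))`. For `N` a fractional Poisson process and
`M` an independent Mittag-Leffler Lévy process this is the generalized fractional negative binomial
process. -/
def timeChange {Ω : Type*} (N : ℝ≥0 → Ω → ℕ) (M : ℝ≥0 → Ω → ℝ≥0) (t : ℝ≥0) (ω : Ω) : ℕ :=
  N (M t ω) ω

end

/-!
Let `φ(u) = lam / (u ^ β + lam)` be the Laplace transform of a waiting time. The binomial
coefficients of a renewal count satisfy
`N(s) choose (k + 1) = ∑ₙ (n choose k) 1{J₁ + ⋯ + Jₙ₊₁ ≤ s}`, so `E[N(s) choose (k + 1)]` is the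
mass of `[0, s]` under a measure whose Laplace transform is
`(φ / (1 - φ)) ^ (k + 1) = (lam u ^ (-β)) ^ (k + 1)`. By uniqueness of Laplace transforms this
measure is a multiple of a Riemann–Liouville measure, whence
`E[N(s) choose k] = lam ^ k s ^ (β k) / Γ(β k + 1)`.

An independent clock `T` replaces `s ^ (β k)` by `E[T ^ (β k)]`, and
`Var X - E X = 2 E[X choose 2] - (E X) ^ 2`. The sign comes from `(E[T ^ β]) ^ 2 ≤ E[T ^ (2 β)]`
and `Γ(2 β) < β Γ(β) ^ 2`, the latter being `B(β, β) > ∫₀¹ x ^ (β - 1) dx = 1 / β` for the Beta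
integral. The moments of `M(t)` of order less than `α` are finite because
`1 - E[exp (-u M(t))] = O(u ^ α)` as `u → 0` bounds the tail `P(M(t) > x)` by `O(x ^ (-α))`.
-/

noncomputable section

open Set Filter Topology
open scoped ENNReal

section LaplaceUniqueness

lemma eqOn_complexMGF_of_mgf_eventuallyEq {Ω Ω' : Type*} [MeasurableSpace Ω] [MeasurableSpace Ω']
    {μ : Measure Ω} {ν : Measure Ω'} {X : Ω → ℝ} {Y : Ω' → ℝ} {v : ℝ}
    (hX : v ∈ interior (integrableExpSet X μ)) (hY : v ∈ interior (integrableExpSet Y ν))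
    (h : mgf X μ =ᶠ[𝓝 v] mgf Y ν) :
    EqOn (complexMGF X μ) (complexMGF Y ν)
      {z | z.re ∈ interior (integrableExpSet X μ) ∩ interior (integrableExpSet Y ν)} := by
  refine AnalyticOnNhd.eqOn_of_preconnected_of_frequently_eq
    (analyticOnNhd_complexMGF.mono fun z hz => hz.1)
    (analyticOnNhd_complexMGF.mono fun z hz => hz.2)
    ((convex_integrableExpSet.interior.inter convex_integrableExpSet.interior).linear_preimage
      Complex.reLm).isPreconnected (z₀ := (v : ℂ)) (by simp [hX, hY]) ?_
  have h_real : ∃ᶠ x : ℝ in 𝓝[≠] v, complexMGF X μ x = complexMGF Y ν x := by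
    refine Eventually.frequently ((h.filter_mono nhdsWithin_le_nhds).mono fun x hx => ?_)
    rw [complexMGF_ofReal, complexMGF_ofReal, hx]
  have h_ofReal : Tendsto ((↑) : ℝ → ℂ) (𝓝[≠] v) (𝓝[≠] (v : ℂ)) :=
    Complex.continuous_ofReal.continuousWithinAt.tendsto_nhdsWithin fun x hx => by simpa using hx
  exact h_ofReal.frequently h_real

lemma charFun_withDensity_exp_mul (μ : Measure ℝ) (v t : ℝ) :
    charFun (μ.withDensity fun x => ENNReal.ofReal (Real.exp (v * x))) t =
      complexMGF id μ (v + t * Complex.I) := by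
  rw [charFun_apply_real, integral_withDensity_eq_integral_toReal_smul (by fun_prop) (by simp),
    complexMGF]
  refine integral_congr_ae (.of_forall fun x => ?_)
  simp only [ENNReal.toReal_ofReal (Real.exp_pos _).le, Complex.real_smul, Complex.ofReal_exp,
    ← Complex.exp_add, id]
  push_cast
  ring_nf

lemma measure_ext_of_mgf_eventuallyEq {μ ν : Measure ℝ} {v : ℝ}
    (hμ : v ∈ interior (integrableExpSet id μ)) (hν : v ∈ interior (integrableExpSet id ν))
    (h : mgf id μ =ᶠ[𝓝 v] mgf id ν) : μ = ν := by
  -- Tilting by `exp (v x)` makes both measures finite, hence determined by their characteristic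
  -- functions, which are the complex moment generating functions on the line `re z = v`.
  set d : ℝ → ℝ≥0∞ := fun x => ENNReal.ofReal (Real.exp (v * x))
  have hd : Measurable d := by fun_prop
  have isFiniteMeasure_tilt {ξ : Measure ℝ} (hξ : v ∈ interior (integrableExpSet id ξ)) :
      IsFiniteMeasure (ξ.withDensity d) :=
    isFiniteMeasure_withDensity_ofReal (interior_subset hξ).2
  have untilt (ξ : Measure ℝ) : (ξ.withDensity d).withDensity d⁻¹ = ξ :=
    withDensity_inv_same hd (.of_forall fun x => by simp [d, Real.exp_pos])
      (.of_forall fun x => ENNReal.ofReal_ne_top)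
  have := isFiniteMeasure_tilt hμ
  have := isFiniteMeasure_tilt hν
  have tilt_eq : μ.withDensity d = ν.withDensity d := Measure.ext_of_charFun <| funext fun t => by
    rw [charFun_withDensity_exp_mul, charFun_withDensity_exp_mul]
    exact eqOn_complexMGF_of_mgf_eventuallyEq hμ hν h (by simpa using ⟨hμ, hν⟩)
  rw [← untilt μ, tilt_eq, untilt]

lemma measure_ext_of_laplace {μ ν : Measure ℝ} {c : ℝ} {L : ℝ → ℝ}
    (hμ : ∀ u, c < u → ∫⁻ x, ENNReal.ofReal (Real.exp (-(u * x))) ∂μ = ENNReal.ofReal (L u))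
    (hν : ∀ u, c < u → ∫⁻ x, ENNReal.ofReal (Real.exp (-(u * x))) ∂ν = ENNReal.ofReal (L u)) :
    μ = ν := by
  have subset_integrableExpSet {ξ : Measure ℝ} (hξ : ∀ u, c < u →
      ∫⁻ x, ENNReal.ofReal (Real.exp (-(u * x))) ∂ξ = ENNReal.ofReal (L u)) :
      Iio (-c) ⊆ integrableExpSet id ξ := by
    refine fun t (ht : t < -c) => ⟨by fun_prop, ?_⟩
    have h := hξ (-t) (by linarith)
    rw [hasFiniteIntegral_iff_ofReal (.of_forall fun x => (Real.exp_pos _).le)]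
    simpa using h.trans_lt ENNReal.ofReal_lt_top
  have mgf_eq {ξ : Measure ℝ} (hξ : ∀ u, c < u →
      ∫⁻ x, ENNReal.ofReal (Real.exp (-(u * x))) ∂ξ = ENNReal.ofReal (L u)) {t : ℝ} (ht : t < -c) :
      mgf id ξ t = (ENNReal.ofReal (L (-t))).toReal := by
    rw [mgf, integral_eq_lintegral_of_nonneg_ae (.of_forall fun x => (Real.exp_pos _).le)
      (by fun_prop), ← hξ (-t) (by linarith)]
    simp
  have hv : -(c + 1) ∈ Iio (-c) := by simp
  refine measure_ext_of_mgf_eventuallyEq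
    (interior_maximal (subset_integrableExpSet hμ) isOpen_Iio hv)
    (interior_maximal (subset_integrableExpSet hν) isOpen_Iio hv) ?_
  filter_upwards [isOpen_Iio.mem_nhds hv] with t ht
  rw [mgf_eq hμ ht, mgf_eq hν ht]

end LaplaceUniqueness

section MittagLefflerLaw

lemma integrableOn_rpow_mul_exp_neg_mul {b u : ℝ} (hb : 0 < b) (hu : 0 < u) :
    IntegrableOn (fun t : ℝ => t ^ (b - 1) * Real.exp (-(u * t))) (Ioi 0) := by
  simpa using integrableOn_rpow_mul_exp_neg_mul_rpow (by linarith : -1 < b - 1) one_pos hu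

lemma integral_rpow_mul_exp_neg_mul_div_Gamma {b u : ℝ} (hb : 0 < b) (hu : 0 < u) :
    ∫ t in Ioi (0 : ℝ), t ^ (b - 1) * Real.exp (-(u * t)) / Real.Gamma b = u ^ (-b) := by
  rw [integral_div, Real.integral_rpow_mul_exp_neg_mul_Ioi hb hu, one_div, Real.inv_rpow hu.le,
    Real.rpow_neg hu.le, mul_div_cancel_right₀ _ (Real.Gamma_pos_of_pos hb).ne']

lemma mittagLeffler_zero (β : ℝ) : mittagLeffler β 0 = 1 := by
  rw [mittagLeffler, tsum_eq_single 0 fun k hk => by simp [hk]]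
  simp

lemma mul_rpow_pow_div_Gamma_mul_exp {β c t : ℝ} (ht : 0 < t) (u : ℝ) (k : ℕ) :
    (c * t ^ β) ^ k / Real.Gamma (β * k + 1) * Real.exp (-(u * t)) =
      c ^ k * (t ^ (β * k + 1 - 1) * Real.exp (-(u * t)) / Real.Gamma (β * k + 1)) := by
  rw [add_sub_cancel_right, Real.rpow_mul ht.le, Real.rpow_natCast, mul_pow]
  ring

lemma integrableOn_mittagLeffler_term {β u : ℝ} (hβ : 0 < β) (c : ℝ) (hu : 0 < u) (k : ℕ) :
    IntegrableOn (fun t : ℝ => (c * t ^ β) ^ k / Real.Gamma (β * k + 1) * Real.exp (-(u * t)))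
      (Ioi 0) :=
  IntegrableOn.congr_fun
    (((integrableOn_rpow_mul_exp_neg_mul (by positivity) hu).div_const _).const_mul _)
    (fun _ ht => (mul_rpow_pow_div_Gamma_mul_exp ht u k).symm) measurableSet_Ioi

lemma integral_mittagLeffler_term {β u : ℝ} (hβ : 0 < β) (c : ℝ) (hu : 0 < u) (k : ℕ) :
    ∫ t in Ioi (0 : ℝ), (c * t ^ β) ^ k / Real.Gamma (β * k + 1) * Real.exp (-(u * t)) =
      u⁻¹ * (c / u ^ β) ^ k := by
  rw [setIntegral_congr_fun measurableSet_Ioi fun t ht => mul_rpow_pow_div_Gamma_mul_exp ht u k,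
    integral_const_mul, integral_rpow_mul_exp_neg_mul_div_Gamma (by positivity) hu,
    Real.rpow_neg hu.le, Real.rpow_add_one hu.ne', Real.rpow_mul hu.le, Real.rpow_natCast,
    div_pow]
  field_simp

lemma integral_norm_mittagLeffler_term {β u : ℝ} (hβ : 0 < β) (c : ℝ) (hu : 0 < u) (k : ℕ) :
    ∫ t in Ioi (0 : ℝ), ‖(c * t ^ β) ^ k / Real.Gamma (β * k + 1) * Real.exp (-(u * t))‖ =
      u⁻¹ * (|c| / u ^ β) ^ k := by
  rw [← integral_mittagLeffler_term hβ |c| hu k]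
  refine setIntegral_congr_fun measurableSet_Ioi fun t (ht : 0 < t) => ?_
  have hG : 0 < Real.Gamma (β * k + 1) := Real.Gamma_pos_of_pos (by positivity)
  simp only [norm_mul, norm_div, norm_pow, Real.norm_eq_abs, Real.abs_exp, abs_of_pos hG,
    abs_of_pos (Real.rpow_pos_of_pos ht β)]

lemma integral_mittagLeffler_mul_exp_neg {β c u : ℝ} (hβ : 0 < β) (hu : 0 < u)
    (hcu : |c| < u ^ β) :
    ∫ t in Ioi (0 : ℝ), mittagLeffler β (c * t ^ β) * Real.exp (-(u * t)) =
      u⁻¹ * (u ^ β / (u ^ β - c)) := by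
  have hu_rpow : 0 < u ^ β := by positivity
  have h_ratio : |c| / u ^ β < 1 := (div_lt_one hu_rpow).2 hcu
  have h_summable : Summable fun k : ℕ => ∫ t in Ioi (0 : ℝ),
      ‖(c * t ^ β) ^ k / Real.Gamma (β * k + 1) * Real.exp (-(u * t))‖ := by
    simp_rw [integral_norm_mittagLeffler_term hβ c hu]
    exact (summable_geometric_of_lt_one (by positivity) h_ratio).mul_left _
  have h_sum : HasSum (fun k => u⁻¹ * (c / u ^ β) ^ k)
      (∫ t in Ioi (0 : ℝ), mittagLeffler β (c * t ^ β) * Real.exp (-(u * t))) := by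
    simp only [mittagLeffler, ← tsum_mul_right, ← integral_mittagLeffler_term hβ c hu]
    exact hasSum_integral_of_summable_integral_norm
      (integrableOn_mittagLeffler_term hβ c hu) h_summable
  have h_geometric : HasSum (fun k : ℕ => (c / u ^ β) ^ k) (1 - c / u ^ β)⁻¹ :=
    hasSum_geometric_of_norm_lt_one <| by
      rwa [norm_div, Real.norm_eq_abs, Real.norm_of_nonneg hu_rpow.le]
  rw [show u ^ β / (u ^ β - c) = (1 - c / u ^ β)⁻¹ by rw [one_sub_div hu_rpow.ne', inv_div]]
  exact h_sum.unique (h_geometric.mul_left u⁻¹)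

section MGF

variable {Ω : Type*} [MeasurableSpace Ω] {P : Measure Ω} {X : Ω → ℝ} {u : ℝ}

lemma integrable_exp_neg_mul [IsFiniteMeasure P] (hX : AEMeasurable X P) (hX0 : 0 ≤ᵐ[P] X)
    (hu : 0 ≤ u) : Integrable (fun ω => Real.exp (-(u * X ω))) P := by
  refine Integrable.of_bound (by fun_prop) 1 (hX0.mono fun ω (hω : 0 ≤ X ω) => ?_)
  rw [Real.norm_of_nonneg (Real.exp_pos _).le, Real.exp_le_one_iff]
  have : 0 ≤ u * X ω := by positivity
  linarith

lemma integral_mul_exp_neg_mul (u x : ℝ) :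
    ∫ t in (0 : ℝ)..x, u * Real.exp (-(u * t)) = 1 - Real.exp (-(u * x)) := by
  have h_deriv (t : ℝ) : HasDerivAt (fun t => -Real.exp (-(u * t))) (u * Real.exp (-(u * t))) t :=
    (((hasDerivAt_id t).const_mul u).neg.exp.neg).congr_deriv (by simp; ring)
  rw [intervalIntegral.integral_eq_sub_of_hasDerivAt (fun t _ => h_deriv t)
    (Continuous.intervalIntegrable (by fun_prop) _ _)]
  simp only [mul_zero, neg_zero, Real.exp_zero]
  ring

lemma one_sub_mgf_neg [IsProbabilityMeasure P] (hX : AEMeasurable X P) (hX0 : 0 ≤ᵐ[P] X)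
    (hu : 0 ≤ u) :
    1 - mgf X P (-u) = u * ∫ t in Ioi (0 : ℝ), P.real {ω | t < X ω} * Real.exp (-(u * t)) := by
  have h_exp := integrable_exp_neg_mul hX hX0 hu
  have h_layercake := lintegral_comp_eq_lintegral_meas_lt_mul P hX0 hX
    (g := fun t => u * Real.exp (-(u * t)))
    (fun t _ => Continuous.intervalIntegrable (by fun_prop) _ _)
    (.of_forall fun t => by positivity)
  simp_rw [integral_mul_exp_neg_mul] at h_layercake
  calc 1 - mgf X P (-u) = ∫ ω, (1 - Real.exp (-(u * X ω))) ∂P := by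
        rw [integral_sub (integrable_const 1) h_exp]
        simp [mgf]
    _ = (∫⁻ t in Ioi 0, P {ω | t < X ω} * ENNReal.ofReal (u * Real.exp (-(u * t)))).toReal := by
        rw [integral_eq_lintegral_of_nonneg_ae _ (by fun_prop), h_layercake]
        filter_upwards [hX0] with ω (hω : 0 ≤ X ω)
        simp [mul_nonneg hu hω]
    _ = ∫ t in Ioi 0, P.real {ω | t < X ω} * (u * Real.exp (-(u * t))) := by
        have h_anti : Antitone fun t => P {ω | t < X ω} :=
          fun s t hst => measure_mono fun ω (hω : t < X ω) => hst.trans_lt hω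
        have h_meas : Measurable fun t => P.real {ω | t < X ω} := h_anti.measurable.ennreal_toReal
        rw [integral_eq_lintegral_of_nonneg_ae (.of_forall fun t => by positivity) (by fun_prop)]
        refine congrArg _ (lintegral_congr fun t => ?_)
        rw [ENNReal.ofReal_mul measureReal_nonneg, ofReal_measureReal]
    _ = _ := by
        rw [← integral_const_mul]
        exact integral_congr_ae (.of_forall fun t => by ring)

lemma mgf_neg_of_mittagLeffler_tail [IsProbabilityMeasure P] {β lam : ℝ} (hβ : 0 < β)
    (hlam : 0 ≤ lam) (hu : 0 < u) (hlu : lam < u ^ β) (hX : AEMeasurable X P) (hX0 : 0 ≤ᵐ[P] X)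
    (h_tail : ∀ t : ℝ, 0 ≤ t → P.real {ω | t < X ω} = mittagLeffler β (-(lam * t ^ β))) :
    mgf X P (-u) = lam / (u ^ β + lam) := by
  have h_one_sub : 1 - mgf X P (-u) = u ^ β / (u ^ β + lam) := by
    rw [one_sub_mgf_neg hX hX0 hu.le, setIntegral_congr_fun measurableSet_Ioi
      fun t ht => by rw [h_tail t (le_of_lt ht), ← neg_mul],
      integral_mittagLeffler_mul_exp_neg hβ hu (by rwa [abs_neg, abs_of_nonneg hlam]),
      mul_inv_cancel_left₀ hu.ne', sub_neg_eq_add]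
  have h_ne : u ^ β + lam ≠ 0 := by positivity
  rw [← sub_sub_cancel 1 (mgf X P (-u)), h_one_sub, one_sub_div h_ne, add_sub_cancel_left]

lemma ae_nonneg_of_mittagLeffler_tail [IsProbabilityMeasure P] {β lam : ℝ} (hβ : β ≠ 0)
    (hX : Measurable X)
    (h_tail : ∀ t : ℝ, 0 ≤ t → P.real {ω | t < X ω} = mittagLeffler β (-(lam * t ^ β))) :
    0 ≤ᵐ[P] X := by
  have h_pos : P.real {ω | 0 < X ω} = 1 := by
    rw [h_tail 0 le_rfl, Real.zero_rpow hβ, mul_zero, neg_zero, mittagLeffler_zero]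
  rw [measureReal_def, ENNReal.toReal_eq_one_iff,
    ← mem_ae_iff_prob_eq_one (measurableSet_lt measurable_const hX)] at h_pos
  filter_upwards [h_pos] with ω (hω : 0 < X ω) using hω.le

end MGF

end MittagLefflerLaw

section RiemannLiouville

/-- The Riemann–Liouville measure of order `b`, with density `x ^ (b - 1) / Γ(b)` on `(0, ∞)`:
convolution with it is fractional integration of order `b`. The renewal measures of a fractional
Poisson process are multiples of it. -/
def riemannLiouvilleMeasure (b : ℝ) : Measure ℝ :=
  (volume.restrict (Ioi 0)).withDensity fun x => ENNReal.ofReal (x ^ (b - 1) / Real.Gamma b)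

variable {b : ℝ}

lemma lintegral_exp_neg_riemannLiouvilleMeasure {u : ℝ} (hb : 0 < b) (hu : 0 < u) :
    ∫⁻ x, ENNReal.ofReal (Real.exp (-(u * x))) ∂riemannLiouvilleMeasure b =
      ENNReal.ofReal (u ^ (-b)) := by
  rw [riemannLiouvilleMeasure,
    lintegral_withDensity_eq_lintegral_mul _ (by fun_prop) (by fun_prop),
    ← integral_rpow_mul_exp_neg_mul_div_Gamma hb hu, ofReal_integral_eq_lintegral_ofReal
      ((integrableOn_rpow_mul_exp_neg_mul hb hu).div_const _)]
  · refine setLIntegral_congr_fun measurableSet_Ioi fun t (ht : 0 < t) => ?_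
    simp only [Pi.mul_apply]
    rw [← ENNReal.ofReal_mul (by positivity), div_mul_eq_mul_div]
  · filter_upwards [ae_restrict_mem measurableSet_Ioi] with t (ht : 0 < t)
    simp only [Pi.zero_apply]
    positivity

lemma riemannLiouvilleMeasure_Iic {s : ℝ} (hb : 0 < b) (hs : 0 ≤ s) :
    riemannLiouvilleMeasure b (Iic s) = ENNReal.ofReal (s ^ b / Real.Gamma (b + 1)) := by
  rw [riemannLiouvilleMeasure, withDensity_apply _ measurableSet_Iic,
    Measure.restrict_restrict measurableSet_Iic, inter_comm, Ioi_inter_Iic,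
    ← ofReal_integral_eq_lintegral_ofReal, ← intervalIntegral.integral_of_le hs,
    intervalIntegral.integral_div, integral_rpow (.inl (by linarith)), sub_add_cancel,
    Real.zero_rpow hb.ne', sub_zero, Real.Gamma_add_one hb.ne', div_div]
  · rw [← IntegrableOn, ← intervalIntegrable_iff_integrableOn_Ioc_of_le hs]
    exact (intervalIntegral.intervalIntegrable_rpow' (by linarith)).div_const _
  · filter_upwards [ae_restrict_mem measurableSet_Ioc] with t ht
    have : 0 < t := ht.1
    simp only [Pi.zero_apply]
    positivity

end RiemannLiouville

section Renewal

lemma hasSum_choose_mul_pow_succ {r : ℝ} (hr : ‖r‖ < 1) (k : ℕ) :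
    HasSum (fun n : ℕ => (n.choose k : ℝ) * r ^ (n + 1)) ((r / (1 - r)) ^ (k + 1)) := by
  have h := (hasSum_choose_mul_geometric_of_norm_lt_one k hr).mul_right (r ^ (k + 1))
  rw [← hasSum_nat_add_iff' k, Finset.sum_eq_zero fun i hi => by
    rw [Nat.choose_eq_zero_of_lt (Finset.mem_range.1 hi), Nat.cast_zero, zero_mul], sub_zero]
  convert! h using 1
  · ext n
    ring
  · rw [div_pow, div_mul_eq_mul_div, one_mul]

lemma sum_range_choose_eq_choose_succ (N k : ℕ) :
    ∑ n ∈ Finset.range N, n.choose k = N.choose (k + 1) := by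
  induction N with
  | zero => simp
  | succ N ih => rw [Finset.sum_range_succ, ih, Nat.choose_succ_succ', add_comm]

lemma lt_renewalCount_iff {Ω : Type*} {J : ℕ → Ω → ℝ} {ω : Ω} {s : ℝ} (hJ0 : ∀ n, 0 ≤ J n ω)
    (h_tendsto : Tendsto (fun n => ∑ i ∈ Finset.range n, J i ω) atTop atTop) (hs : 0 ≤ s) (n : ℕ) :
    n < renewalCount J s ω ↔ ∑ i ∈ Finset.range (n + 1), J i ω ≤ s := by
  have h_mono : Monotone fun n => ∑ i ∈ Finset.range n, J i ω :=
    monotone_nat_of_le_succ fun n => by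
      rw [Finset.sum_range_succ]
      exact le_add_of_nonneg_right (hJ0 n)
  have h_bdd : BddAbove {n : ℕ | ∑ i ∈ Finset.range n, J i ω ≤ s} := by
    obtain ⟨k, hk⟩ := (h_tendsto.eventually_gt_atTop s).exists
    exact ⟨k, fun n hn => (h_mono.reflect_lt (hn.trans_lt hk)).le⟩
  have h_nonempty : {n : ℕ | ∑ i ∈ Finset.range n, J i ω ≤ s}.Nonempty := ⟨0, by simpa using hs⟩
  exact ⟨fun h => (h_mono h).trans (Nat.sSup_mem h_nonempty h_bdd), fun h => le_csSup h_bdd h⟩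

variable {Ω : Type*} [MeasurableSpace Ω] {P : Measure Ω} {J : ℕ → Ω → ℝ}

/-- The `k`-th binomial renewal measure `∑ₙ (n choose k) P(S (n + 1) ∈ ·)` of the waiting times `J`,
where `S n = J 0 + ⋯ + J (n - 1)`. For `k = 0` it is the usual renewal measure; in general it
carries the `(k + 1)`-st binomial moment of the counting process. -/
def renewalMeasure (P : Measure Ω) (J : ℕ → Ω → ℝ) (k : ℕ) : Measure ℝ :=
  Measure.sum fun n => (n.choose k : ℝ≥0∞) • P.map fun ω => ∑ i ∈ Finset.range (n + 1), J i ω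

lemma renewalMeasure_Iic (hJ : ∀ n, Measurable (J n)) (k : ℕ) (s : ℝ) :
    renewalMeasure P J k (Iic s) =
      ∑' n, (n.choose k : ℝ≥0∞) * P {ω | ∑ i ∈ Finset.range (n + 1), J i ω ≤ s} := by
  rw [renewalMeasure, Measure.sum_apply _ measurableSet_Iic]
  refine tsum_congr fun n => ?_
  rw [Measure.smul_apply, Measure.map_apply (by fun_prop) measurableSet_Iic, smul_eq_mul]
  rfl

lemma lintegral_exp_neg_mul_sum (hJ : ∀ n, Measurable (J n)) (h_indep : iIndepFun J P) {u φ : ℝ}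
    (hφ : 0 < φ) (h_mgf : ∀ n, mgf (J n) P (-u) = φ) (n : ℕ) :
    ∫⁻ ω, ENNReal.ofReal (Real.exp (-(u * ∑ i ∈ Finset.range n, J i ω))) ∂P =
      ENNReal.ofReal (φ ^ n) := by
  have h_int (i : ℕ) : Integrable (fun ω => Real.exp (-u * J i ω)) P := by
    by_contra h_not
    exact hφ.ne' ((h_mgf i).symm.trans (mgf_undef h_not))
  have := h_indep.isProbabilityMeasure
  have h_prod := h_indep.mgf_sum hJ (t := -u) (Finset.range n)
  have h_sum_int := h_indep.integrable_exp_mul_sum hJ (s := Finset.range n) fun i _ => h_int i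
  rw [Finset.prod_congr rfl fun i _ => h_mgf i, Finset.prod_const, Finset.card_range] at h_prod
  rw [← h_prod, mgf, ofReal_integral_eq_lintegral_ofReal h_sum_int
    (.of_forall fun ω => (Real.exp_pos _).le)]
  simp only [Finset.sum_apply, neg_mul]

lemma lintegral_exp_neg_renewalMeasure (hJ : ∀ n, Measurable (J n)) (h_indep : iIndepFun J P)
    {u φ : ℝ} (hφ : 0 < φ) (hφ1 : φ < 1) (h_mgf : ∀ n, mgf (J n) P (-u) = φ) (k : ℕ) :
    ∫⁻ x, ENNReal.ofReal (Real.exp (-(u * x))) ∂renewalMeasure P J k =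
      ENNReal.ofReal ((φ / (1 - φ)) ^ (k + 1)) := by
  have h_sum := hasSum_choose_mul_pow_succ (r := φ) (by rwa [Real.norm_of_nonneg hφ.le]) k
  rw [renewalMeasure, lintegral_sum_measure, ← h_sum.tsum_eq,
    ENNReal.ofReal_tsum_of_nonneg (fun n => by positivity) h_sum.summable]
  refine tsum_congr fun n => ?_
  rw [lintegral_smul_measure, lintegral_map (by fun_prop) (by fun_prop),
    lintegral_exp_neg_mul_sum hJ h_indep hφ h_mgf, smul_eq_mul,
    ENNReal.ofReal_mul (Nat.cast_nonneg _), ENNReal.ofReal_natCast]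

lemma lintegral_choose_succ_eq_renewalMeasure_Iic (hJ : ∀ n, Measurable (J n)) {s : ℝ} {N : Ω → ℕ}
    (hN : ∀ᵐ ω ∂P, ∀ n, n < N ω ↔ ∑ i ∈ Finset.range (n + 1), J i ω ≤ s) (k : ℕ) :
    ∫⁻ ω, ((N ω).choose (k + 1) : ℝ≥0∞) ∂P = renewalMeasure P J k (Iic s) := by
  have h_meas (n : ℕ) : MeasurableSet {ω | ∑ i ∈ Finset.range (n + 1), J i ω ≤ s} :=
    measurableSet_le (by fun_prop) measurable_const
  have h_choose : ∀ᵐ ω ∂P, ((N ω).choose (k + 1) : ℝ≥0∞) =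
      ∑' n, {ω | ∑ i ∈ Finset.range (n + 1), J i ω ≤ s}.indicator
        (fun _ => (n.choose k : ℝ≥0∞)) ω := by
    filter_upwards [hN] with ω hω
    rw [tsum_eq_sum (s := Finset.range (N ω)) fun n hn =>
      indicator_of_notMem (by simpa [← hω] using hn) _, ← sum_range_choose_eq_choose_succ,
      Nat.cast_sum]
    refine Finset.sum_congr rfl fun n hn => ?_
    rw [indicator_of_mem (by exact (hω n).1 (Finset.mem_range.1 hn))]
  rw [lintegral_congr_ae h_choose,
    lintegral_tsum fun n => (measurable_const.indicator (h_meas n)).aemeasurable,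
    renewalMeasure_Iic hJ]
  exact tsum_congr fun n => lintegral_indicator_const (h_meas n) _

lemma ae_tendsto_sum_atTop (hJ : ∀ n, Measurable (J n))
    (h_fin : ∀ s : ℕ, renewalMeasure P J 0 (Iic (s : ℝ)) ≠ ∞) :
    ∀ᵐ ω ∂P, Tendsto (fun n => ∑ i ∈ Finset.range n, J i ω) atTop atTop := by
  have h_borel_cantelli : ∀ᵐ ω ∂P, ∀ s : ℕ, ∀ᶠ n in atTop,
      ω ∉ {ω | ∑ i ∈ Finset.range (n + 1), J i ω ≤ s} :=
    ae_all_iff.2 fun s => ae_eventually_notMem (by simpa [renewalMeasure_Iic hJ] using h_fin s)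
  filter_upwards [h_borel_cantelli] with ω hω
  refine (tendsto_add_atTop_iff_nat 1).1 (tendsto_atTop.2 fun b => ?_)
  obtain ⟨s, hs⟩ := exists_nat_ge b
  exact (hω s).mono fun n hn => hs.trans (not_le.1 hn).le

end Renewal

section FractionalPoisson

variable {Ω : Type*} [MeasurableSpace Ω] {P : Measure Ω} [IsProbabilityMeasure P] {β lam : ℝ}

lemma renewalMeasure_eq_smul_riemannLiouvilleMeasure {J : ℕ → Ω → ℝ} (hβ : 0 < β) (hlam : 0 < lam)
    (hJ : ∀ n, Measurable (J n)) (h_indep : iIndepFun J P)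
    (h_tail : ∀ n, ∀ t : ℝ, 0 ≤ t → P.real {ω | t < J n ω} = mittagLeffler β (-(lam * t ^ β)))
    (k : ℕ) :
    renewalMeasure P J k =
      ENNReal.ofReal (lam ^ (k + 1)) • riemannLiouvilleMeasure (β * (k + 1 : ℕ)) := by
  refine measure_ext_of_laplace (c := lam ^ β⁻¹) (L := fun u => (lam / u ^ β) ^ (k + 1))
    (fun u hu => ?_) (fun u hu => ?_)
  all_goals have hu0 : 0 < u := (by positivity : 0 < lam ^ β⁻¹).trans hu
  · have hlu : lam < u ^ β := (Real.rpow_inv_lt_iff_of_pos hlam.le hu0.le hβ).1 hu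
    have h_mgf (n : ℕ) : mgf (J n) P (-u) = lam / (u ^ β + lam) :=
      mgf_neg_of_mittagLeffler_tail hβ hlam.le hu0 hlu (hJ n).aemeasurable
        (ae_nonneg_of_mittagLeffler_tail hβ.ne' (hJ n) (h_tail n)) (h_tail n)
    have h_lt : lam / (u ^ β + lam) < 1 := (div_lt_one (by positivity)).2 (by linarith)
    have h_odds : lam / (u ^ β + lam) / (1 - lam / (u ^ β + lam)) = lam / u ^ β := by
      rw [one_sub_div (by positivity), add_sub_cancel_right,
        div_div_div_cancel_right₀ (by positivity)]
    rw [lintegral_exp_neg_renewalMeasure hJ h_indep (by positivity) h_lt h_mgf, h_odds]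
  · rw [lintegral_smul_measure, lintegral_exp_neg_riemannLiouvilleMeasure (by positivity) hu0,
      smul_eq_mul, ← ENNReal.ofReal_mul (by positivity), Real.rpow_neg hu0.le,
      Real.rpow_mul hu0.le, Real.rpow_natCast, div_pow, div_eq_mul_inv]

namespace IsFractionalPoissonProcess

variable {N : ℝ≥0 → Ω → ℕ}

lemma exists_lt_iff_sum_le (hN : IsFractionalPoissonProcess β lam N P) (hβ : 0 < β)
    (hlam : 0 < lam) :
    ∃ J : ℕ → Ω → ℝ, (∀ n, Measurable (J n)) ∧
      (∀ᵐ ω ∂P, ∀ t n, n < N t ω ↔ ∑ i ∈ Finset.range (n + 1), J i ω ≤ t) ∧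
      ∀ k, renewalMeasure P J k =
        ENNReal.ofReal (lam ^ (k + 1)) • riemannLiouvilleMeasure (β * (k + 1 : ℕ)) := by
  obtain ⟨J, hJ, h_indep, h_tail, h_count⟩ := hN.renewal
  have h_renewal := renewalMeasure_eq_smul_riemannLiouvilleMeasure hβ hlam hJ h_indep h_tail
  refine ⟨J, hJ, ?_, h_renewal⟩
  have h_nonneg : ∀ᵐ ω ∂P, ∀ n, 0 ≤ J n ω :=
    ae_all_iff.2 fun n => ae_nonneg_of_mittagLeffler_tail hβ.ne' (hJ n) (h_tail n)
  have h_tendsto := ae_tendsto_sum_atTop hJ fun s => by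
    rw [h_renewal, Measure.smul_apply, riemannLiouvilleMeasure_Iic (by positivity) s.cast_nonneg]
    exact ENNReal.mul_ne_top ENNReal.ofReal_ne_top ENNReal.ofReal_ne_top
  filter_upwards [h_nonneg, h_tendsto, h_count] with ω h0 htop hc t n
  rw [hc, lt_renewalCount_iff h0 htop t.coe_nonneg]

lemma lintegral_choose (hN : IsFractionalPoissonProcess β lam N P) (hβ : 0 < β) (hlam : 0 < lam)
    (k : ℕ) (s : ℝ≥0) :
    ∫⁻ ω, ((N s ω).choose k : ℝ≥0∞) ∂P =
      ENNReal.ofReal (lam ^ k / Real.Gamma (β * k + 1) * (s : ℝ) ^ (β * k)) := by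
  obtain - | k := k
  · simp
  obtain ⟨J, hJ, h_iff, h_renewal⟩ := hN.exists_lt_iff_sum_le hβ hlam
  rw [lintegral_choose_succ_eq_renewalMeasure_Iic hJ (h_iff.mono fun ω hω => hω s), h_renewal,
    Measure.smul_apply, riemannLiouvilleMeasure_Iic (by positivity) s.coe_nonneg, smul_eq_mul,
    ← ENNReal.ofReal_mul (by positivity), mul_div_left_comm, mul_comm]

lemma ae_monotone_rightContinuous (hN : IsFractionalPoissonProcess β lam N P) (hβ : 0 < β)
    (hlam : 0 < lam) :
    ∀ᵐ ω ∂P, Monotone (N · ω) ∧ ∀ t, ContinuousWithinAt (N · ω) (Ioi t) t := by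
  obtain ⟨J, -, h_iff, -⟩ := hN.exists_lt_iff_sum_le hβ hlam
  filter_upwards [h_iff] with ω hω
  have h_mono : Monotone (N · ω) := fun s t hst => le_of_forall_lt fun n hn =>
    (hω t n).2 (((hω s n).1 hn).trans (NNReal.coe_le_coe.2 hst))
  refine ⟨h_mono, fun t => ?_⟩
  have h_next : (t : ℝ) < ∑ i ∈ Finset.range (N t ω + 1), J i ω :=
    not_le.1 fun h => lt_irrefl _ ((hω t _).2 h)
  have h_const : ∀ᶠ s in 𝓝[>] t, N t ω = N s ω := by
    filter_upwards [self_mem_nhdsWithin, mem_nhdsWithin_of_mem_nhds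
      (NNReal.continuous_coe.continuousAt.eventually_lt continuousAt_const h_next)] with s hts hs
    exact (h_mono (le_of_lt hts)).antisymm (not_lt.1 fun h => not_le.2 hs ((hω s _).1 h))
  exact tendsto_const_nhds.congr' h_const

end IsFractionalPoissonProcess

end FractionalPoisson

section RandomEvaluation

variable {ι : Type*} [LinearOrder ι] [TopologicalSpace ι] [TopologicalSpace.SeparableSpace ι]
  [Nonempty ι]

/-- The right limit at `t` of a monotone path `p`, as an infimum over a countable dense set so that
it is jointly measurable in the path and the time, which pointwise evaluation is not. -/
def rightEval (p : ι → ℝ≥0∞) (t : ι) : ℝ≥0∞ :=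
  ⨅ n : ℕ, if t < TopologicalSpace.denseSeq ι n then p (TopologicalSpace.denseSeq ι n) else ⊤

lemma measurable_uncurry_rightEval [OrderClosedTopology ι] [MeasurableSpace ι]
    [OpensMeasurableSpace ι] : Measurable (Function.uncurry (rightEval (ι := ι))) :=
  Measurable.iInf fun _ => Measurable.ite (measurable_snd measurableSet_Iio)
    ((measurable_pi_apply _).comp measurable_fst) measurable_const

lemma rightEval_eq_of_monotone [OrderTopology ι] [DenselyOrdered ι] [NoMaxOrder ι]
    {p : ι → ℝ≥0∞} (hp : Monotone p) {t : ι} (ht : ContinuousWithinAt p (Ioi t) t) :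
    rightEval p t = p t := by
  refine le_antisymm (le_of_forall_gt fun c hc => ?_) (le_iInf fun n => ?_)
  · obtain ⟨b, htb, hb⟩ := (mem_nhdsGT_iff_exists_Ioo_subset).1 (ht.eventually_lt_const hc)
    obtain ⟨_, ⟨n, rfl⟩, hn⟩ := (TopologicalSpace.denseRange_denseSeq ι).exists_between htb
    exact (iInf_le _ n).trans_lt (by rw [if_pos hn.1]; exact hb hn)
  · split_ifs with h
    exacts [hp h.le, le_top]

variable [OrderTopology ι] [DenselyOrdered ι] [NoMaxOrder ι] [MeasurableSpace ι]
  [OpensMeasurableSpace ι] {Ω : Type*} [MeasurableSpace Ω] {P : Measure Ω} {Z : ι → Ω → ℝ≥0∞}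
  {T : Ω → ι}

lemma aemeasurable_eval_of_monotone (hZ : ∀ t, Measurable (Z t))
    (h_path : ∀ᵐ ω ∂P, Monotone (Z · ω) ∧ ∀ t, ContinuousWithinAt (Z · ω) (Ioi t) t)
    (hT : AEMeasurable T P) : AEMeasurable (fun ω => Z (T ω) ω) P := by
  have h_meas : AEMeasurable (fun ω => rightEval (Z · ω) (T ω)) P :=
    measurable_uncurry_rightEval.comp_aemeasurable
      ((measurable_pi_lambda _ hZ).aemeasurable.prodMk hT)
  exact h_meas.congr (h_path.mono fun ω hω => rightEval_eq_of_monotone hω.1 (hω.2 _))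

lemma lintegral_eval_of_indepFun [IsFiniteMeasure P] (hZ : ∀ t, Measurable (Z t))
    (h_path : ∀ᵐ ω ∂P, Monotone (Z · ω) ∧ ∀ t, ContinuousWithinAt (Z · ω) (Ioi t) t)
    (hT : AEMeasurable T P) (h_indep : IndepFun (fun ω t => Z t ω) T P) :
    ∫⁻ ω, Z (T ω) ω ∂P = ∫⁻ ω, ∫⁻ ω', Z (T ω) ω' ∂P ∂P := by
  have hZ_path : Measurable fun ω t => Z t ω := measurable_pi_lambda _ hZ
  have h_eval : Measurable (Function.uncurry (rightEval (ι := ι))) := measurable_uncurry_rightEval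
  have h_eval_eq : ∀ᵐ ω ∂P, ∀ t, rightEval (Z · ω) t = Z t ω :=
    h_path.mono fun ω hω t => rightEval_eq_of_monotone hω.1 (hω.2 t)
  calc ∫⁻ ω, Z (T ω) ω ∂P = ∫⁻ ω, rightEval (Z · ω) (T ω) ∂P :=
        lintegral_congr_ae (h_eval_eq.mono fun ω hω => (hω _).symm)
    _ = ∫⁻ p, Function.uncurry rightEval p ∂((P.map fun ω t => Z t ω).prod (P.map T)) := by
        rw [← (indepFun_iff_map_prod_eq_prod_map_map hZ_path.aemeasurable hT).1 h_indep]
        exact (lintegral_map' h_eval.aemeasurable (hZ_path.aemeasurable.prodMk hT)).symm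
    _ = ∫⁻ ω, ∫⁻ p, rightEval p (T ω) ∂(P.map fun ω t => Z t ω) ∂P := by
        rw [lintegral_prod_symm _ h_eval.aemeasurable]
        exact lintegral_map' h_eval.lintegral_prod_left'.aemeasurable hT
    _ = ∫⁻ ω, ∫⁻ ω', Z (T ω) ω' ∂P ∂P := lintegral_congr fun ω =>
        (lintegral_map (h_eval.comp measurable_prodMk_right) hZ_path).trans
          (lintegral_congr_ae (h_eval_eq.mono fun ω' hω' => hω' _))

end RandomEvaluation

section Overdispersion

variable {Ω : Type*} [MeasurableSpace Ω] {P : Measure Ω}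

lemma cast_sq_eq_two_mul_choose_two_add (n : ℕ) : (n : ℝ) ^ 2 = 2 * (n.choose 2 : ℝ) + n := by
  rw [Nat.cast_choose_two]
  ring

lemma memLp_two_of_integrable_choose_two {X : Ω → ℕ} (hX : Integrable (fun ω => (X ω : ℝ)) P)
    (hX2 : Integrable (fun ω => ((X ω).choose 2 : ℝ)) P) : MemLp (fun ω => (X ω : ℝ)) 2 P := by
  rw [memLp_two_iff_integrable_sq hX.aestronglyMeasurable]
  simp only [cast_sq_eq_two_mul_choose_two_add]
  exact (hX2.const_mul 2).add hX

lemma variance_sub_integral_eq_choose_two [IsProbabilityMeasure P] {X : Ω → ℕ}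
    (hX : Integrable (fun ω => (X ω : ℝ)) P)
    (hX2 : Integrable (fun ω => ((X ω).choose 2 : ℝ)) P) :
    variance (fun ω => (X ω : ℝ)) P - ∫ ω, (X ω : ℝ) ∂P =
      2 * ∫ ω, ((X ω).choose 2 : ℝ) ∂P - (∫ ω, (X ω : ℝ) ∂P) ^ 2 := by
  rw [variance_eq_sub (memLp_two_of_integrable_choose_two hX hX2)]
  simp only [Pi.pow_apply, cast_sq_eq_two_mul_choose_two_add]
  rw [integral_add (hX2.const_mul 2) hX, integral_const_mul]
  ring

lemma memLp_two_rpow_of_integrable {X : Ω → ℝ} (hX : AEMeasurable X P) (hX0 : 0 ≤ᵐ[P] X) {p : ℝ}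
    (h : Integrable (fun ω => X ω ^ (2 * p)) P) : MemLp (fun ω => X ω ^ p) 2 P := by
  rw [memLp_two_iff_integrable_sq (hX.pow_const p).aestronglyMeasurable]
  refine h.congr (hX0.mono fun ω hω => ?_)
  simp only [mul_comm 2 p, Real.rpow_mul hω, Real.rpow_two]

lemma integrable_rpow_of_integrable_rpow_two_mul [IsFiniteMeasure P] {X : Ω → ℝ}
    (hX : AEMeasurable X P) (hX0 : 0 ≤ᵐ[P] X) {p : ℝ}
    (h : Integrable (fun ω => X ω ^ (2 * p)) P) : Integrable (fun ω => X ω ^ p) P :=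
  (memLp_two_rpow_of_integrable hX hX0 h).integrable one_le_two

lemma sq_integral_rpow_le [IsProbabilityMeasure P] {X : Ω → ℝ} (hX : AEMeasurable X P)
    (hX0 : 0 ≤ᵐ[P] X) {p : ℝ} (h : Integrable (fun ω => X ω ^ (2 * p)) P) :
    (∫ ω, X ω ^ p ∂P) ^ 2 ≤ ∫ ω, X ω ^ (2 * p) ∂P := by
  have h_var := variance_nonneg (fun ω => X ω ^ p) P
  rw [variance_eq_sub (memLp_two_rpow_of_integrable hX hX0 h), sub_nonneg] at h_var
  refine h_var.trans_eq (integral_congr_ae (hX0.mono fun ω hω => ?_))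
  simp only [Pi.pow_apply, mul_comm 2 p, Real.rpow_mul hω, Real.rpow_two]

lemma integral_rpow_pos {X : Ω → ℝ} (hX0 : 0 ≤ᵐ[P] X) (hX : ¬ X =ᵐ[P] 0) {p : ℝ} (hp : p ≠ 0)
    (h : Integrable (fun ω => X ω ^ p) P) : 0 < ∫ ω, X ω ^ p ∂P := by
  have h_nonneg : 0 ≤ᵐ[P] fun ω => X ω ^ p := hX0.mono fun ω hω => Real.rpow_nonneg hω p
  refine (integral_nonneg_of_ae h_nonneg).lt_of_ne fun h_zero => hX ?_
  filter_upwards [(integral_eq_zero_iff_of_nonneg_ae h_nonneg h).1 h_zero.symm, hX0] with ω hω h0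
  exact (Real.rpow_eq_zero h0 hp).1 hω

lemma lintegral_Ioo_rpow_sub_one {a c : ℝ} (ha : 0 < a) (hc : 0 ≤ c) :
    ∫⁻ x in Ioo (0 : ℝ) 1, ENNReal.ofReal (c * x ^ (a - 1)) = ENNReal.ofReal (c * a⁻¹) := by
  have h_int : IntegrableOn (fun x : ℝ => c * x ^ (a - 1)) (Ioo 0 1) :=
    ((intervalIntegral.integrableOn_Ioo_rpow_iff one_pos).2 (by linarith)).const_mul c
  rw [← ofReal_integral_eq_lintegral_ofReal h_int
      ((ae_restrict_mem measurableSet_Ioo).mono fun x hx =>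
        mul_nonneg hc (Real.rpow_nonneg hx.1.le _)),
    ← integral_Ioc_eq_integral_Ioo, ← intervalIntegral.integral_of_le zero_le_one,
    intervalIntegral.integral_const_mul, integral_rpow (.inl (by linarith))]
  simp [ha.ne']

lemma inv_lt_beta {a b : ℝ} (ha : 0 < a) (hb : 0 < b) (hb1 : b < 1) : a⁻¹ < beta a b := by
  have h_beta : 0 < beta a b := beta_pos ha hb
  have h_lt : ENNReal.ofReal (1 / beta a b * a⁻¹) < 1 := by
    rw [← lintegral_betaPDF_eq_one ha hb, lintegral_betaPDF,
      ← lintegral_Ioo_rpow_sub_one ha (by positivity)]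
    refine setLIntegral_strict_mono measurableSet_Ioo (by simp) (by fun_prop)
      (by rw [lintegral_Ioo_rpow_sub_one ha (by positivity)]; exact ENNReal.ofReal_ne_top)
      (.of_forall fun x hx => ?_)
    have hx0 : 0 < x := hx.1
    have h_one_lt : 1 < (1 - x) ^ (b - 1) :=
      Real.one_lt_rpow_of_pos_of_lt_one_of_neg (sub_pos.2 hx.2) (by linarith) (by linarith)
    exact (ENNReal.ofReal_lt_ofReal_iff (by positivity)).2
      (lt_mul_of_one_lt_right (by positivity) h_one_lt)
  rwa [ENNReal.ofReal_lt_one, one_div_mul_eq_div, div_lt_one h_beta] at h_lt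

lemma Gamma_add_lt_mul_Gamma_mul_Gamma {a b : ℝ} (ha : 0 < a) (hb : 0 < b) (hb1 : b < 1) :
    Real.Gamma (a + b) < a * (Real.Gamma a * Real.Gamma b) := by
  have h := inv_lt_beta ha hb hb1
  rwa [beta, lt_div_iff₀ (Real.Gamma_pos_of_pos (add_pos ha hb)), inv_mul_lt_iff₀ ha] at h

lemma Gamma_two_mul_lt_mul_sq {a : ℝ} (ha : 0 < a) (ha1 : a < 1) :
    Real.Gamma (2 * a) < a * Real.Gamma a ^ 2 := by
  simpa only [two_mul, sq] using Gamma_add_lt_mul_Gamma_mul_Gamma ha ha ha1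

end Overdispersion

namespace IsFractionalPoissonProcess

variable {Ω : Type*} [MeasurableSpace Ω] {P : Measure Ω} {β lam : ℝ} {N : ℝ≥0 → Ω → ℕ}

lemma measurable_choose (hN : IsFractionalPoissonProcess β lam N P) (k : ℕ) (t : ℝ≥0) :
    Measurable fun ω => ((N t ω).choose k : ℝ≥0∞) :=
  (Measurable.of_discrete (f := fun n : ℕ => (n.choose k : ℝ≥0∞))).comp (hN.measurable t)

variable [IsProbabilityMeasure P] {T : Ω → ℝ≥0}

lemma ae_monotone_rightContinuous_choose (hN : IsFractionalPoissonProcess β lam N P) (hβ : 0 < β)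
    (hlam : 0 < lam) (k : ℕ) :
    ∀ᵐ ω ∂P, Monotone (fun t => ((N t ω).choose k : ℝ≥0∞)) ∧
      ∀ t, ContinuousWithinAt (fun t => ((N t ω).choose k : ℝ≥0∞)) (Ioi t) t :=
  (hN.ae_monotone_rightContinuous hβ hlam).mono fun _ hω =>
    ⟨fun _ _ hst => Nat.cast_le.2 (Nat.choose_le_choose k (hω.1 hst)), fun t =>
      (continuous_of_discreteTopology (f := fun n : ℕ => (n.choose k : ℝ≥0∞))).continuousAt
        |>.comp_continuousWithinAt (hω.2 t)⟩

lemma aemeasurable_choose_eval (hN : IsFractionalPoissonProcess β lam N P) (hβ : 0 < β)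
    (hlam : 0 < lam) (hT : AEMeasurable T P) (k : ℕ) :
    AEMeasurable (fun ω => ((N (T ω) ω).choose k : ℝ≥0∞)) P :=
  aemeasurable_eval_of_monotone (hN.measurable_choose k)
    (hN.ae_monotone_rightContinuous_choose hβ hlam k) hT

lemma lintegral_choose_eval (hN : IsFractionalPoissonProcess β lam N P) (hβ : 0 < β)
    (hlam : 0 < lam) (hT : AEMeasurable T P) (h_indep : IndepFun (fun ω t => N t ω) T P) {k : ℕ}
    (h_int : Integrable (fun ω => (T ω : ℝ) ^ (β * k)) P) :
    ∫⁻ ω, ((N (T ω) ω).choose k : ℝ≥0∞) ∂P =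
      ENNReal.ofReal (lam ^ k / Real.Gamma (β * k + 1) * ∫ ω, (T ω : ℝ) ^ (β * k) ∂P) := by
  have h_indep_choose : IndepFun (fun ω t => ((N t ω).choose k : ℝ≥0∞)) T P :=
    h_indep.comp (measurable_pi_lambda _ fun t =>
      (Measurable.of_discrete (f := fun n : ℕ => (n.choose k : ℝ≥0∞))).comp
        (measurable_pi_apply t)) measurable_id
  rw [lintegral_eval_of_indepFun (hN.measurable_choose k)
    (hN.ae_monotone_rightContinuous_choose hβ hlam k) hT h_indep_choose, ← integral_const_mul,
    ofReal_integral_eq_lintegral_ofReal (h_int.const_mul _) (.of_forall fun ω => by positivity)]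
  simp only [hN.lintegral_choose hβ hlam]

lemma integrable_choose_eval (hN : IsFractionalPoissonProcess β lam N P) (hβ : 0 < β)
    (hlam : 0 < lam) (hT : AEMeasurable T P) (h_indep : IndepFun (fun ω t => N t ω) T P) {k : ℕ}
    (h_int : Integrable (fun ω => (T ω : ℝ) ^ (β * k)) P) :
    Integrable (fun ω => ((N (T ω) ω).choose k : ℝ)) P := by
  simpa only [ENNReal.toReal_natCast] using
    integrable_toReal_of_lintegral_ne_top (hN.aemeasurable_choose_eval hβ hlam hT k)
      (by simp [hN.lintegral_choose_eval hβ hlam hT h_indep h_int])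

lemma integral_choose_eval (hN : IsFractionalPoissonProcess β lam N P) (hβ : 0 < β)
    (hlam : 0 < lam) (hT : AEMeasurable T P) (h_indep : IndepFun (fun ω t => N t ω) T P) {k : ℕ}
    (h_int : Integrable (fun ω => (T ω : ℝ) ^ (β * k)) P) :
    ∫ ω, ((N (T ω) ω).choose k : ℝ) ∂P =
      lam ^ k / Real.Gamma (β * k + 1) * ∫ ω, (T ω : ℝ) ^ (β * k) ∂P := by
  have h_toReal := integral_toReal (hN.aemeasurable_choose_eval hβ hlam hT k)
    (.of_forall fun _ => ENNReal.natCast_lt_top _)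
  simp only [ENNReal.toReal_natCast] at h_toReal
  rw [h_toReal, hN.lintegral_choose_eval hβ hlam hT h_indep h_int, ENNReal.toReal_ofReal
    (mul_nonneg (by positivity) (integral_nonneg fun ω => by positivity))]

lemma integrable_eval (hN : IsFractionalPoissonProcess β lam N P) (hβ : 0 < β)
    (hlam : 0 < lam) (hT : AEMeasurable T P) (h_indep : IndepFun (fun ω t => N t ω) T P)
    (h_int : Integrable (fun ω => (T ω : ℝ) ^ β) P) :
    Integrable (fun ω => (N (T ω) ω : ℝ)) P := by
  simpa using hN.integrable_choose_eval hβ hlam hT h_indep (k := 1) (by simpa using h_int)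

lemma integral_eval (hN : IsFractionalPoissonProcess β lam N P) (hβ : 0 < β)
    (hlam : 0 < lam) (hT : AEMeasurable T P) (h_indep : IndepFun (fun ω t => N t ω) T P)
    (h_int : Integrable (fun ω => (T ω : ℝ) ^ β) P) :
    ∫ ω, (N (T ω) ω : ℝ) ∂P = lam / Real.Gamma (β + 1) * ∫ ω, (T ω : ℝ) ^ β ∂P := by
  simpa using hN.integral_choose_eval hβ hlam hT h_indep (k := 1) (by simpa using h_int)

lemma memLp_two_eval (hN : IsFractionalPoissonProcess β lam N P) (hβ : 0 < β) (hlam : 0 < lam)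
    (hT : AEMeasurable T P) (h_indep : IndepFun (fun ω t => N t ω) T P)
    (h_int : Integrable (fun ω => (T ω : ℝ) ^ (2 * β)) P) :
    MemLp (fun ω => (N (T ω) ω : ℝ)) 2 P :=
  memLp_two_of_integrable_choose_two
    (hN.integrable_eval hβ hlam hT h_indep (integrable_rpow_of_integrable_rpow_two_mul
      hT.coe_nnreal_real (.of_forall fun ω => (T ω).coe_nonneg) h_int))
    (hN.integrable_choose_eval hβ hlam hT h_indep (by simpa [mul_comm β] using h_int))

lemma variance_sub_integral_eval (hN : IsFractionalPoissonProcess β lam N P) (hβ : 0 < β)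
    (hlam : 0 < lam) (hT : AEMeasurable T P) (h_indep : IndepFun (fun ω t => N t ω) T P)
    (h_int : Integrable (fun ω => (T ω : ℝ) ^ (2 * β)) P) :
    variance (fun ω => (N (T ω) ω : ℝ)) P - ∫ ω, (N (T ω) ω : ℝ) ∂P =
      lam ^ 2 / β * ((∫ ω, (T ω : ℝ) ^ (2 * β) ∂P) / Real.Gamma (2 * β)
        - (∫ ω, (T ω : ℝ) ^ β ∂P) ^ 2 / (β * Real.Gamma β ^ 2)) := by
  have h_int_one : Integrable (fun ω => (T ω : ℝ) ^ β) P :=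
    integrable_rpow_of_integrable_rpow_two_mul hT.coe_nnreal_real
      (.of_forall fun ω => (T ω).coe_nonneg) h_int
  have h_int_two : Integrable (fun ω => (T ω : ℝ) ^ (β * (2 : ℕ))) P := by
    simpa [mul_comm β] using h_int
  rw [variance_sub_integral_eq_choose_two (hN.integrable_eval hβ hlam hT h_indep h_int_one)
      (hN.integrable_choose_eval hβ hlam hT h_indep h_int_two),
    hN.integral_choose_eval hβ hlam hT h_indep h_int_two,
    hN.integral_eval hβ hlam hT h_indep h_int_one, Nat.cast_ofNat, mul_comm β 2,
    Real.Gamma_add_one hβ.ne', Real.Gamma_add_one (by positivity)]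
  field_simp

lemma variance_sub_integral_eval_nonneg (hN : IsFractionalPoissonProcess β lam N P) (hβ : 0 < β)
    (hβ1 : β < 1) (hlam : 0 < lam) (hT : AEMeasurable T P)
    (h_indep : IndepFun (fun ω t => N t ω) T P)
    (h_int : Integrable (fun ω => (T ω : ℝ) ^ (2 * β)) P) :
    0 ≤ variance (fun ω => (N (T ω) ω : ℝ)) P - ∫ ω, (N (T ω) ω : ℝ) ∂P := by
  have h_sq := sq_integral_rpow_le hT.coe_nnreal_real
    (.of_forall fun ω => (T ω).coe_nonneg) h_int
  rw [hN.variance_sub_integral_eval hβ hlam hT h_indep h_int]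
  refine mul_nonneg (by positivity) (sub_nonneg.2 ?_)
  gcongr
  exact (Gamma_two_mul_lt_mul_sq hβ hβ1).le

lemma variance_sub_integral_eval_pos (hN : IsFractionalPoissonProcess β lam N P) (hβ : 0 < β)
    (hβ1 : β < 1) (hlam : 0 < lam) (hT : AEMeasurable T P)
    (h_indep : IndepFun (fun ω t => N t ω) T P)
    (h_int : Integrable (fun ω => (T ω : ℝ) ^ (2 * β)) P)
    (hT_ne : ¬ (fun ω => (T ω : ℝ)) =ᵐ[P] 0) :
    0 < variance (fun ω => (N (T ω) ω : ℝ)) P - ∫ ω, (N (T ω) ω : ℝ) ∂P := by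
  have hT0 : 0 ≤ᵐ[P] fun ω => (T ω : ℝ) := .of_forall fun ω => (T ω).coe_nonneg
  have h_sq := sq_integral_rpow_le hT.coe_nnreal_real hT0 h_int
  have h_mean : 0 < ∫ ω, (T ω : ℝ) ^ β ∂P := integral_rpow_pos hT0 hT_ne hβ.ne'
    (integrable_rpow_of_integrable_rpow_two_mul hT.coe_nnreal_real hT0 h_int)
  rw [hN.variance_sub_integral_eval hβ hlam hT h_indep h_int]
  refine mul_pos (by positivity) (sub_pos.2 ?_)
  calc (∫ ω, (T ω : ℝ) ^ β ∂P) ^ 2 / (β * Real.Gamma β ^ 2)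
      < (∫ ω, (T ω : ℝ) ^ β ∂P) ^ 2 / Real.Gamma (2 * β) := by
        gcongr
        exact Gamma_two_mul_lt_mul_sq hβ hβ1
    _ ≤ (∫ ω, (T ω : ℝ) ^ (2 * β) ∂P) / Real.Gamma (2 * β) := by gcongr

end IsFractionalPoissonProcess

section LaplaceTail

variable {Ω : Type*} [MeasurableSpace Ω] {P : Measure Ω} {X : Ω → ℝ}

lemma measureReal_lt_le_mul_one_sub_laplace [IsProbabilityMeasure P] (hX : AEMeasurable X P)
    (hX0 : 0 ≤ᵐ[P] X) {t : ℝ} (ht : 0 < t) :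
    P.real {ω | t < X ω} ≤
      (1 - Real.exp (-1))⁻¹ * (1 - ∫ ω, Real.exp (-(t⁻¹ * X ω)) ∂P) := by
  have h_exp := integrable_exp_neg_mul hX hX0 (inv_nonneg.2 ht.le)
  have h_const : 0 < 1 - Real.exp (-1) := by simp
  have h_subset : {ω | t < X ω} ⊆ {ω | 1 - Real.exp (-1) ≤ 1 - Real.exp (-(t⁻¹ * X ω))} := by
    intro ω (hω : t < X ω)
    have h_one_le : 1 ≤ t⁻¹ * X ω := (one_le_inv_mul₀ ht).2 hω.le
    rw [mem_ofPred_eq]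
    gcongr
  have h_markov := mul_meas_ge_le_integral_of_nonneg
    (f := fun ω => 1 - Real.exp (-(t⁻¹ * X ω)))
    (hX0.mono fun ω (hω : 0 ≤ X ω) => by
      have : 0 ≤ t⁻¹ * X ω := by positivity
      simpa using this)
    ((integrable_const 1).sub h_exp) (1 - Real.exp (-1))
  rw [integral_sub (integrable_const 1) h_exp, integral_const, probReal_univ, one_smul] at h_markov
  exact (le_inv_mul_iff₀ h_const).2
    ((mul_le_mul_of_nonneg_left (measureReal_mono h_subset) h_const.le).trans h_markov)

lemma integrable_rpow_of_tail_le [IsFiniteMeasure P] (hX : AEMeasurable X P) (hX0 : 0 ≤ᵐ[P] X)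
    {C a p : ℝ} (hp : 0 < p) (hpa : p < a)
    (h_tail : ∀ t, 1 < t → P.real {ω | t < X ω} ≤ C * t ^ (-a)) :
    Integrable (fun ω => X ω ^ p) P := by
  refine ⟨(hX.pow_const p).aestronglyMeasurable, ?_⟩
  rw [hasFiniteIntegral_iff_ofReal (hX0.mono fun ω hω => Real.rpow_nonneg hω _),
    lintegral_rpow_eq_lintegral_meas_lt_mul P hX0 hX hp]
  refine ENNReal.mul_lt_top ENNReal.ofReal_lt_top ?_
  rw [← Ioc_union_Ioi_eq_Ioi (zero_le_one' ℝ), lintegral_union measurableSet_Ioi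
    Ioc_disjoint_Ioi_same]
  refine ENNReal.add_lt_top.2 ⟨?_, ?_⟩
  · have h_int : IntegrableOn (fun t : ℝ => t ^ (p - 1)) (Ioc 0 1) :=
      (intervalIntegrable_iff_integrableOn_Ioc_of_le zero_le_one).1
        (intervalIntegral.intervalIntegrable_rpow' (by linarith))
    calc ∫⁻ t in Ioc 0 1, P {ω | t < X ω} * ENNReal.ofReal (t ^ (p - 1))
        ≤ ∫⁻ t in Ioc 0 1, P univ * ENNReal.ofReal (t ^ (p - 1)) := by gcongr; simp
      _ = P univ * ∫⁻ t in Ioc 0 1, ENNReal.ofReal (t ^ (p - 1)) :=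
          lintegral_const_mul' _ _ (measure_ne_top P univ)
      _ < ∞ := ENNReal.mul_lt_top (measure_lt_top P univ) h_int.lintegral_lt_top
  · have h_int : IntegrableOn (fun t : ℝ => C * t ^ (p - 1 - a)) (Ioi 1) :=
      (integrableOn_Ioi_rpow_of_lt (by linarith) one_pos).const_mul C
    refine (setLIntegral_mono (by fun_prop) fun t (ht : 1 < t) => ?_).trans_lt
      h_int.lintegral_lt_top
    have ht0 : 0 < t := one_pos.trans ht
    calc P {ω | t < X ω} * ENNReal.ofReal (t ^ (p - 1))
        ≤ ENNReal.ofReal (C * t ^ (-a)) * ENNReal.ofReal (t ^ (p - 1)) := by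
          rw [← ofReal_measureReal]
          gcongr
          exact h_tail t ht
      _ = ENNReal.ofReal (C * t ^ (p - 1 - a)) := by
          rw [← ENNReal.ofReal_mul' (by positivity), mul_assoc, ← Real.rpow_add ht0,
            neg_add_eq_sub]

lemma integrable_rpow_of_one_sub_laplace_le [IsProbabilityMeasure P] (hX : AEMeasurable X P)
    (hX0 : 0 ≤ᵐ[P] X) {K a p : ℝ} (hp : 0 < p) (hpa : p < a)
    (h_laplace : ∀ u, 0 < u → u < 1 → 1 - ∫ ω, Real.exp (-(u * X ω)) ∂P ≤ K * u ^ a) :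
    Integrable (fun ω => X ω ^ p) P := by
  refine integrable_rpow_of_tail_le (C := (1 - Real.exp (-1))⁻¹ * K) hX hX0 hp hpa fun t ht => ?_
  have ht0 : 0 < t := one_pos.trans ht
  have h_const : 0 < 1 - Real.exp (-1) := by simp
  calc P.real {ω | t < X ω}
      ≤ (1 - Real.exp (-1))⁻¹ * (1 - ∫ ω, Real.exp (-(t⁻¹ * X ω)) ∂P) :=
        measureReal_lt_le_mul_one_sub_laplace hX hX0 ht0
    _ ≤ (1 - Real.exp (-1))⁻¹ * (K * t⁻¹ ^ a) := by
        gcongr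
        exact h_laplace t⁻¹ (inv_pos.2 ht0) (inv_lt_one_of_one_lt₀ ht)
    _ = (1 - Real.exp (-1))⁻¹ * K * t ^ (-a) := by
        rw [mul_assoc, Real.inv_rpow ht0.le, Real.rpow_neg ht0.le]

lemma one_sub_mul_le_div_add_rpow {μ x c : ℝ} (hμ : 0 < μ) (hx : 0 ≤ x) (hc : 0 ≤ c) :
    1 - c / μ * x ≤ (μ / (μ + x)) ^ c := by
  have h_log : -(x / μ) ≤ Real.log (μ / (μ + x)) := by
    refine le_trans (le_of_eq ?_) (Real.one_sub_inv_le_log_of_pos (by positivity))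
    field_simp
    ring
  calc 1 - c / μ * x = -(x / μ) * c + 1 := by ring
    _ ≤ Real.log (μ / (μ + x)) * c + 1 := by gcongr
    _ ≤ Real.exp (Real.log (μ / (μ + x)) * c) := Real.add_one_le_exp _
    _ = (μ / (μ + x)) ^ c := (Real.rpow_def_of_pos (by positivity) c).symm

variable {α μ c : ℝ}

lemma integrable_rpow_of_laplace_eq [IsProbabilityMeasure P] (hX : AEMeasurable X P)
    (hX0 : 0 ≤ᵐ[P] X) (hμ : 0 < μ) (hc : 0 ≤ c)
    (h_laplace : ∀ u, 0 ≤ u → ∫ ω, Real.exp (-(u * X ω)) ∂P = (μ / (μ + u ^ α)) ^ c) {p : ℝ}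
    (hp : 0 < p) (hpα : p < α) : Integrable (fun ω => X ω ^ p) P :=
  integrable_rpow_of_one_sub_laplace_le hX hX0 (K := c / μ) hp hpα fun u hu _ => by
    rw [h_laplace u hu.le]
    linarith [one_sub_mul_le_div_add_rpow hμ (Real.rpow_nonneg hu.le α) hc]

lemma not_ae_eq_zero_of_laplace_eq [IsProbabilityMeasure P] (hμ : 0 < μ) (hc : 0 < c)
    (h_laplace : ∀ u, 0 ≤ u → ∫ ω, Real.exp (-(u * X ω)) ∂P = (μ / (μ + u ^ α)) ^ c) :
    ¬ X =ᵐ[P] 0 := by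
  intro h_zero
  have h_lt : (μ / (μ + 1)) ^ c < 1 :=
    Real.rpow_lt_one (by positivity) ((div_lt_one (by positivity)).2 (by linarith)) hc
  have h_one : ∫ ω, Real.exp (-(1 * X ω)) ∂P = 1 := by
    rw [integral_congr_ae (h_zero.mono fun ω hω => by rw [hω])]
    simp
  rw [h_laplace 1 zero_le_one, Real.one_rpow] at h_one
  exact h_lt.ne h_one

end LaplaceTail

end

theorem lemmal1_general {Ω : Type*} [MeasurableSpace Ω] (P : Measure Ω) [IsProbabilityMeasure P]
    (α ρ μ : ℝ) (hα1 : α ≤ 1) (hρ : 0 < ρ) (hμ : 0 < μ)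
    (M : ℝ≥0 → Ω → ℝ≥0) (hM : ∀ t, Measurable (M t))
    (h_laplace : ∀ t : ℝ≥0, ∀ u : ℝ, 0 ≤ u →
      ∫ ω, Real.exp (-(u * (M t ω : ℝ))) ∂P = (μ / (μ + u ^ α)) ^ (ρ * (t : ℝ))) :
    (∀ l : ℝ, 0 < l → l < α / 2 → ∀ t : ℝ≥0,
      Integrable (fun ω => (M t ω : ℝ) ^ l) P ∧
      Integrable (fun ω => (M t ω : ℝ) ^ (2 * l)) P ∧
      (∫ ω, (M t ω : ℝ) ^ l ∂P) ^ 2 ≤ ∫ ω, (M t ω : ℝ) ^ (2 * l) ∂P) ∧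
    (∀ β lam : ℝ, 0 < β → β < α / 2 → 0 < lam →
      ∀ N : ℝ≥0 → Ω → ℕ, IsFractionalPoissonProcess β lam N P →
      IndepFun (fun ω t => N t ω) (fun ω t => M t ω) P →
      ∀ t : ℝ≥0,
        MemLp (fun ω => (timeChange N M t ω : ℝ)) 2 P ∧
        variance (fun ω => (timeChange N M t ω : ℝ)) P - ∫ ω, (timeChange N M t ω : ℝ) ∂P =
          lam ^ 2 / β * ((∫ ω, (M t ω : ℝ) ^ (2 * β) ∂P) / Real.Gamma (2 * β)
            - (∫ ω, (M t ω : ℝ) ^ β ∂P) ^ 2 / (β * Real.Gamma β ^ 2)) ∧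
        0 ≤ variance (fun ω => (timeChange N M t ω : ℝ)) P
          - ∫ ω, (timeChange N M t ω : ℝ) ∂P ∧
        (0 < t → 0 < variance (fun ω => (timeChange N M t ω : ℝ)) P
          - ∫ ω, (timeChange N M t ω : ℝ) ∂P)) := by
  have h_meas (t : ℝ≥0) : AEMeasurable (fun ω => (M t ω : ℝ)) P :=
    (hM t).coe_nnreal_real.aemeasurable
  have h_nonneg (t : ℝ≥0) : 0 ≤ᵐ[P] fun ω => (M t ω : ℝ) := .of_forall fun ω => (M t ω).coe_nonneg
  have h_moment (p : ℝ) (hp : 0 < p) (hpα : p < α) (t : ℝ≥0) :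
      Integrable (fun ω => (M t ω : ℝ) ^ p) P :=
    integrable_rpow_of_laplace_eq (h_meas t) (h_nonneg t) hμ (by positivity) (h_laplace t) hp hpα
  refine ⟨fun l hl hlα t => ?_, fun β lam hβ hβα hlam N hN h_indep t => ?_⟩
  · have h_two := h_moment (2 * l) (by linarith) (by linarith) t
    exact ⟨h_moment l hl (by linarith) t, h_two,
      sq_integral_rpow_le (h_meas t) (h_nonneg t) h_two⟩
  · have h_two := h_moment (2 * β) (by linarith) (by linarith) t
    have h_indep_t : IndepFun (fun ω t => N t ω) (M t) P :=
      h_indep.comp measurable_id (measurable_pi_apply t)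
    have hMt := (hM t).aemeasurable (μ := P)
    have hβ1 : β < 1 := by linarith
    exact ⟨hN.memLp_two_eval hβ hlam hMt h_indep_t h_two,
      hN.variance_sub_integral_eval hβ hlam hMt h_indep_t h_two,
      hN.variance_sub_integral_eval_nonneg hβ hβ1 hlam hMt h_indep_t h_two,
      fun ht => hN.variance_sub_integral_eval_pos hβ hβ1 hlam hMt h_indep_t h_two
        (not_ae_eq_zero_of_laplace_eq hμ (mul_pos hρ ht) (h_laplace t))⟩

theorem lemmal1 {Ω : Type*} [MeasurableSpace Ω] (P : Measure Ω) [IsProbabilityMeasure P]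
    (α ρ μ : ℝ) (hα : 0 < α) (hα1 : α < 1) (hρ : 0 < ρ) (hμ : 0 < μ)
    (M : ℝ≥0 → Ω → ℝ≥0) (hM : IsMittagLefflerLevyProcess α ρ μ M P) :
    (∀ l : ℝ, 0 < l → l < α / 2 → ∀ t : ℝ≥0,
      Integrable (fun ω => (M t ω : ℝ) ^ l) P ∧
      Integrable (fun ω => (M t ω : ℝ) ^ (2 * l)) P ∧
      (∫ ω, (M t ω : ℝ) ^ l ∂P) ^ 2 ≤ ∫ ω, (M t ω : ℝ) ^ (2 * l) ∂P) ∧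
    (∀ β lam : ℝ, 0 < β → β < α / 2 → 0 < lam →
      ∀ N : ℝ≥0 → Ω → ℕ, IsFractionalPoissonProcess β lam N P →
      IndepFun (fun ω t => N t ω) (fun ω t => M t ω) P →
      ∀ t : ℝ≥0,
        MemLp (fun ω => (timeChange N M t ω : ℝ)) 2 P ∧
        variance (fun ω => (timeChange N M t ω : ℝ)) P - ∫ ω, (timeChange N M t ω : ℝ) ∂P =
          lam ^ 2 / β * ((∫ ω, (M t ω : ℝ) ^ (2 * β) ∂P) / Real.Gamma (2 * β)
            - (∫ ω, (M t ω : ℝ) ^ β ∂P) ^ 2 / (β * Real.Gamma β ^ 2)) ∧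
        0 ≤ variance (fun ω => (timeChange N M t ω : ℝ)) P
          - ∫ ω, (timeChange N M t ω : ℝ) ∂P ∧
        (0 < t → 0 < variance (fun ω => (timeChange N M t ω : ℝ)) P
          - ∫ ω, (timeChange N M t ω : ℝ) ∂P)) :=
  lemmal1_general P α ρ μ hα1.le hρ hμ M hM.measurable hM.laplace
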